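/- Let $\mathbb D$ be the open unit disc in $\mathbb C$ and let $\mathbb G_3=\{(t_1+t_2+t_3,\;t_1t_2+t_1t_3+t_2t_3,\;t_1t_2t_3): t_1,t_2,t_3\in\mathbb D\}\subset\mathbb C^3$ be the symmetrized tridisc. For a domain $D\subset\mathbb C^n$, $z\in D$, $X\in\mathbb C^n$ and an integer $k\ge 1$, the $k$-th Reiffen pseudometric is $$\gamma_D^{(k)}(z;X)=\sup\left\{\left|\frac{f^{(k)}(z)X}{k!}\right|^{1/k}: f\colon D\to\mathbb D \text{ holomorphic},\ \operatorname{ord}_z f\ge k\right\},$$ where $f^{(k)}(z)X$ is the $k$-th derivative of $f$ at $z$ evaluated at $(X,\dots,X)$, and $\operatorname{ord}_z f\ge k$ means that all derivatives of $f$ of order less than $k$ (including $f$ itself) vanish at $z$. Let $\hat\gamma_D^{(k)}(z;\cdot)$ be the largest (complex) pseudonorm on $\mathbb C^n$ that does not exceed $\gamma_D^{(k)}(z;\cdot)$. Then, with $e_2=(0,1,0)$, $$\hat\gamma^{(2)}_{\mathbb G_3}(0;e_2)\ \ge\ C_1:=\sqrt{0.675},$$ and $C_1=0.8215\ldots$,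 that is, $0.8215<C_1<0.8216$. -/

import Mathlib

noncomputable section

/-- The symmetrization map `σ_n : ℂⁿ → ℂⁿ`. Coordinates are indexed from `0`, so the coordinate with
index `k` is the elementary symmetric polynomial of degree `k + 1`. -/
def symmetrization (n : ℕ) (t : Fin n → ℂ) : Fin n → ℂ :=
  fun k => ∑ s ∈ Finset.powersetCard ((k : ℕ) + 1) (Finset.univ : Finset (Fin n)), ∏ i ∈ s, t i

/-- The symmetrized `n`-disc `𝔾_n = σ_n(𝔻ⁿ)`. -/
def symmetrizedPolydisc (n : ℕ) : Set (Fin n → ℂ) :=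
  symmetrization n '' {t | ∀ i, ‖t i‖ < 1}

/-- The competitors for the `k`-th Reiffen pseudometric of `D` at `z`: the holomorphic functions
from `D` to the open unit disc whose order of vanishing at `z` is at least `k`. -/
def reiffenCompetitors {E : Type*} [NormedAddCommGroup E] [NormedSpace ℂ E]
    (k : ℕ) (D : Set E) (z : E) : Set (E → ℂ) :=
  {f | DifferentiableOn ℂ f D ∧ Set.MapsTo f D (Metric.ball (0 : ℂ) 1) ∧
    ∀ j < k, iteratedFDeriv ℂ j f z = 0}

/-- The `k`-th Reiffen pseudometric (`k ≥ 1`, `D` open, `z ∈ D`):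
`γ_D^{(k)}(z; X) = sup |f^{(k)}(z) X / k!|^{1/k}`, where `f^{(k)}(z) X` is the `k`-th derivative of
`f` at `z` evaluated at `(X, …, X)`. The set of which the supremum is taken contains `0`, and for a
domain `D` of `ℂⁿ` and `z ∈ D` it is bounded by the Cauchy estimates. -/
def reiffen {E : Type*} [NormedAddCommGroup E] [NormedSpace ℂ E]
    (k : ℕ) (D : Set E) (z X : E) : ℝ :=
  sSup ((fun f : E → ℂ =>
    ‖iteratedFDeriv ℂ k f z (fun _ => X) / (k.factorial : ℂ)‖ ^ (1 / (k : ℝ))) ''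
      reiffenCompetitors k D z)

/-- The largest (complex) pseudonorm that does not exceed the function `g`, for `g ≥ 0`. -/
def largestPseudonormBelow {E : Type*} [AddCommGroup E] [Module ℂ E] (g : E → ℝ) : Seminorm ℂ E :=
  sSup {p : Seminorm ℂ E | ∀ X, p X ≤ g X}

/-- `largestPseudonormBelow g` is indeed the largest pseudonorm not exceeding `g`. -/
theorem largestPseudonormBelow_isGreatest {E : Type*} [AddCommGroup E] [Module ℂ E]
    (g : E → ℝ) (hg : ∀ X, 0 ≤ g X) :
    IsGreatest {p : Seminorm ℂ E | ∀ X, p X ≤ g X} (largestPseudonormBelow g) := by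
  have hb : BddAbove ((↑) '' {p : Seminorm ℂ E | ∀ X, p X ≤ g X} : Set (E → ℝ)) := by
    refine ⟨g, ?_⟩
    rintro _ ⟨p, hp, rfl⟩
    exact hp
  have hb' := Seminorm.bddAbove_iff.mpr hb
  have hne : {p : Seminorm ℂ E | ∀ X, p X ≤ g X}.Nonempty := ⟨0, hg⟩
  refine ⟨fun X => ?_, fun p hp => le_csSup hb' hp⟩
  have : Nonempty {p : Seminorm ℂ E | ∀ X, p X ≤ g X} := hne.to_subtype
  rw [largestPseudonormBelow, Seminorm.sSup_apply hb']
  exact ciSup_le fun p => p.2 X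

/-- The Reiffen pseudometrics are nonnegative. -/
theorem reiffen_nonneg {E : Type*} [NormedAddCommGroup E] [NormedSpace ℂ E]
    (k : ℕ) (D : Set E) (z X : E) : 0 ≤ reiffen k D z X := by
  refine Real.sSup_nonneg ?_
  rintro _ ⟨f, -, rfl⟩
  positivity

/-- `γ̂_D^{(k)}(z; ·)`, the largest pseudonorm that does not exceed `γ_D^{(k)}(z; ·)`. -/
def reiffenHat {E : Type*} [NormedAddCommGroup E] [NormedSpace ℂ E]
    (k : ℕ) (D : Set E) (z : E) : Seminorm ℂ E :=
  largestPseudonormBelow (reiffen k D z)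

end

/-! One competitor suffices: `quarticCompetitor`, whose second-order part at `0` is `0.675 * X 1 ^
2`. It gives `√0.675 * ‖X 1‖ ≤ γ⁽²⁾(0; X)` for every `X`; the left side is a seminorm, hence lies
below the largest one. The work is to show that it maps `𝔾₃` into the disc. By the maximum principle
it is enough to bound it on the torus. There, with `z = p + q + r` and `u = pqr`, the second
symmetric function is `conj z * u`, so the squared modulus is a convex quadratic in `Y = 2 Re (z³
conj u)` with coefficients depending on `‖z‖`. Since `|Y| ≤ 2‖z‖³` and the squared modulus of the
Vandermonde product is nonnegative, `Y` is confined to an interval, and only its endpoints need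
checking. -/

/-! ### Real inequalities over the deltoid of values of `z`. -/

/-- A convex quadratic on an interval is at most the larger of its endpoint values. -/
theorem quadratic_le_of_endpoints {A B C l u Y M : ℝ} (hC : 0 ≤ C) (hl : l ≤ Y) (hu : Y ≤ u)
    (hL : A + B * l + C * l ^ 2 ≤ M) (hU : A + B * u + C * u ^ 2 ≤ M) :
    A + B * Y + C * Y ^ 2 ≤ M := by
  rcases eq_or_lt_of_le (hl.trans hu) with h | h
  · have : Y = l := le_antisymm (by linarith) hl
    subst this; exact hL
  · have h1 : 0 ≤ C * ((Y - l) * (u - Y)) * (u - l) := by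
      have := sub_nonneg.2 hl; have := sub_nonneg.2 hu; have := sub_pos.2 h; positivity
    have h2 : (A + B * Y + C * Y ^ 2) * (u - l) ≤ M * (u - l) := by
      nlinarith [mul_le_mul_of_nonneg_left hL (sub_nonneg.2 hu),
        mul_le_mul_of_nonneg_left hU (sub_nonneg.2 hl)]
    exact le_of_mul_le_mul_right h2 (sub_pos.2 h)

theorem deltoid_edge_bound {s : ℝ} (h1 : 1 ≤ s) (h9 : s ≤ 9) :
    (0.675 ^ 2 * s ^ 2 + 0.291 ^ 2 * s ^ 3 + 0.033 ^ 2 * s ^ 4 - 2 * 0.675 * 0.033 * s ^ 3) +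
      (-0.675 * 0.291 * s - 0.291 * 0.033 * s ^ 2) * ((s ^ 2 + 18 * s - 27) / 4) +
      0.675 * 0.033 * ((s ^ 2 + 18 * s - 27) / 4) ^ 2 ≤ 1 := by
  rcases le_total s 4 with h | h
  · nlinarith [mul_nonneg (sub_nonneg.2 h1) (sub_nonneg.2 h), sq_nonneg (s ^ 2 - 6 * s + 8),
      mul_nonneg (sub_nonneg.2 h1) (sq_nonneg (s - 3)), sq_nonneg (s - 3),
      mul_nonneg (sub_nonneg.2 h) (sq_nonneg (s - 2)),
      mul_nonneg (mul_nonneg (sub_nonneg.2 h1) (sub_nonneg.2 h)) (sq_nonneg (s - 2)),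
      mul_nonneg (mul_nonneg (sub_nonneg.2 h1) (sub_nonneg.2 h)) (sq_nonneg (s - 3))]
  · nlinarith [mul_nonneg (sub_nonneg.2 h) (sub_nonneg.2 h9),
      mul_nonneg (sub_nonneg.2 h) (sq_nonneg (s - 4)), sq_nonneg (s - 4),
      mul_nonneg (mul_nonneg (sub_nonneg.2 h) (sub_nonneg.2 h9)) (sq_nonneg (s - 4)),
      mul_nonneg (sub_nonneg.2 h9) (sq_nonneg (s - 4))]

theorem deltoid_axis_bound {r : ℝ} (h0 : 0 ≤ r) (h3 : r ≤ 3) :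
    |0.675 * r ^ 2 - 0.291 * r ^ 3 + 0.033 * r ^ 4| ≤ 1 := by
  rw [abs_le]
  constructor
  · nlinarith [mul_nonneg (sq_nonneg r) (sq_nonneg (r - 4)), sq_nonneg r]
  · nlinarith [sq_nonneg (r ^ 2 - 4 * r), sq_nonneg (r - 2.5), sq_nonneg (r*(r - 2.5)), mul_nonneg h0 (sub_nonneg.2 h3),
      mul_nonneg h0 (sq_nonneg (r - 2.5)), mul_nonneg (sub_nonneg.2 h3) (sq_nonneg (r - 2.5)),
      mul_nonneg (mul_nonneg h0 (sub_nonneg.2 h3)) (sq_nonneg (r - 2.5))]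

theorem deltoid_bound {r Y : ℝ} (h0 : 0 ≤ r) (h3 : r ≤ 3) (hl : -(2 * r ^ 3) ≤ Y)
    (hu : Y ≤ 2 * r ^ 3) (hd : 0 ≤ 27 - 18 * r ^ 2 + 4 * Y - r ^ 4) :
    0.675 ^ 2 * r ^ 4 + 0.291 ^ 2 * r ^ 6 + 0.033 ^ 2 * r ^ 8 - 0.675 * 0.291 * r ^ 2 * Y -
      0.291 * 0.033 * r ^ 4 * Y + 0.675 * 0.033 * (Y ^ 2 - 2 * r ^ 6) ≤ 1 := by
  have hU := (sq_le_one_iff_abs_le_one _).2 (deltoid_axis_bound h0 h3)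
  have key : ∀ l, l ≤ Y →
      (0.675 ^ 2 * r ^ 4 + 0.291 ^ 2 * r ^ 6 + 0.033 ^ 2 * r ^ 8 - 2 * 0.675 * 0.033 * r ^ 6) +
        (-0.675 * 0.291 * r ^ 2 - 0.291 * 0.033 * r ^ 4) * l + 0.675 * 0.033 * l ^ 2 ≤ 1 →
      0.675 ^ 2 * r ^ 4 + 0.291 ^ 2 * r ^ 6 + 0.033 ^ 2 * r ^ 8 - 0.675 * 0.291 * r ^ 2 * Y -
        0.291 * 0.033 * r ^ 4 * Y + 0.675 * 0.033 * (Y ^ 2 - 2 * r ^ 6) ≤ 1 := by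
    intro l hlY hL
    have := quadratic_le_of_endpoints (by norm_num) hlY hu hL (by linear_combination hU)
    linear_combination this
  rcases le_total r 1 with h | h
  -- Here `-2r³` is the lower endpoint; the quadratic is then a perfect square with base at most
  -- `0.675 + 0.291 + 0.033 = 0.999`.
  · refine key _ hl ?_
    have h2 : r ^ 2 ≤ 1 := pow_le_one₀ h0 h
    have h3 : r ^ 3 ≤ 1 := pow_le_one₀ h0 h
    have h4 : r ^ 4 ≤ 1 := pow_le_one₀ h0 h
    have : (0.675 * r ^ 2 + 0.291 * r ^ 3 + 0.033 * r ^ 4) ^ 2 ≤ 1 :=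
      pow_le_one₀ (by positivity) (by linarith)
    linear_combination this
  · refine key ((r ^ 4 + 18 * r ^ 2 - 27) / 4) (by linarith) ?_
    have := deltoid_edge_bound (s := r ^ 2) (one_le_pow₀ h) (by nlinarith)
    linear_combination this

/-! ### The quartic on the torus and on the polydisc. -/

open ComplexConjugate in
theorem norm_eq_one_conj {t : ℂ} (h : ‖t‖ = 1) : t ≠ 0 ∧ conj t = t⁻¹ :=
  ⟨by rintro rfl; simp at h, (Complex.inv_eq_conj h).symm⟩

open ComplexConjugate in
theorem normSq_discriminant_of_norm_eq_one {p q r : ℂ} (hp : ‖p‖ = 1) (hq : ‖q‖ = 1)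
    (hr : ‖r‖ = 1) :
    Complex.normSq ((p - q) * (q - r) * (r - p)) =
      27 - 18 * ‖p + q + r‖ ^ 2 + 4 * (2 * ((p + q + r) ^ 3 * conj (p * q * r)).re) -
        ‖p + q + r‖ ^ 4 := by
  obtain ⟨p0, hp'⟩ := norm_eq_one_conj hp
  obtain ⟨q0, hq'⟩ := norm_eq_one_conj hq
  obtain ⟨r0, hr'⟩ := norm_eq_one_conj hr
  rw [show ‖p + q + r‖ ^ 4 = (‖p + q + r‖ ^ 2) ^ 2 by ring]
  simp only [← Complex.normSq_eq_norm_sq]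
  have key := Complex.add_conj ((p + q + r) ^ 3 * conj (p * q * r))
  apply Complex.ofReal_injective
  push_cast at key ⊢
  rw [← key]
  simp only [← Complex.mul_conj]
  simp only [map_mul, map_add, map_sub, map_pow, hp', hq', hr', map_inv₀, inv_inv]
  field_simp
  ring

open ComplexConjugate in
theorem norm_quartic_le_one_of_norm_eq_one {p q r : ℂ} (hp : ‖p‖ = 1) (hq : ‖q‖ = 1)
    (hr : ‖r‖ = 1) :
    ‖0.675 * (p * q + p * r + q * r) ^ 2 - 0.291 * (p + q + r) ^ 2 * (p * q + p * r + q * r) +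
      0.033 * (p + q + r) ^ 4‖ ≤ 1 := by
  have hd := normSq_discriminant_of_norm_eq_one hp hq hr
  have hd0 := Complex.normSq_nonneg ((p - q) * (q - r) * (r - p))
  obtain ⟨p0, hp'⟩ := norm_eq_one_conj hp
  obtain ⟨q0, hq'⟩ := norm_eq_one_conj hq
  obtain ⟨r0, hr'⟩ := norm_eq_one_conj hr
  set z := p + q + r with hz
  set Y := 2 * (z ^ 3 * conj (p * q * r)).re with hY
  have h3 : ‖z‖ ≤ 3 := by
    have := norm_add₃_le (a := p) (b := q) (c := r)
    linarith
  have habs : |(z ^ 3 * conj (p * q * r)).re| ≤ ‖z‖ ^ 3 := by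
    refine (Complex.abs_re_le_norm _).trans (le_of_eq ?_)
    simp [hp, hq, hr]
  rw [abs_le] at habs
  have hb := deltoid_bound (norm_nonneg z) h3 (Y := Y) (by linarith [habs.1])
    (by linarith [habs.2]) (by linarith)
  rw [← sq_le_one_iff₀ (norm_nonneg _)]
  refine le_trans (le_of_eq ?_) hb
  have e (n : ℕ) : ‖z‖ ^ (2 * n) = Complex.normSq z ^ n := by
    rw [Complex.normSq_eq_norm_sq, pow_mul]
  rw [← Complex.normSq_eq_norm_sq, show ‖z‖ ^ 8 = Complex.normSq z ^ 4 from e 4,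
    show ‖z‖ ^ 6 = Complex.normSq z ^ 3 from e 3, show ‖z‖ ^ 4 = Complex.normSq z ^ 2 from e 2,
    show ‖z‖ ^ 2 = Complex.normSq z by rw [Complex.normSq_eq_norm_sq]]
  have key := Complex.add_conj (z ^ 3 * conj (p * q * r))
  rw [← hY] at key
  have hu : p * q * r * conj (p * q * r) = 1 := by
    simp only [map_mul, hp', hq', hr']; field_simp
  have h2 : p * q + p * r + q * r = conj z * (p * q * r) := by
    rw [hz]; simp only [map_add, hp', hq', hr']; field_simp; ring
  apply Complex.ofReal_injective
  push_cast
  rw [← key, h2]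
  generalize p * q * r = u at *
  clear_value z
  have cz : ∀ w : ℂ, conj (0.675 * (conj w * u) ^ 2 - 0.291 * w ^ 2 * (conj w * u) + 0.033 * w ^ 4)
      = 0.675 * (w * conj u) ^ 2 - 0.291 * conj w ^ 2 * (w * conj u) + 0.033 * conj w ^ 4 := by
    intro w
    have k : ∀ x : ℝ, conj (x : ℂ) = x := Complex.conj_ofReal
    have k1 := k 0.675
    have k2 := k 0.291
    have k3 := k 0.033
    push_cast at k1 k2 k3
    simp only [map_mul, map_add, map_sub, map_pow, Complex.conj_conj, k1, k2, k3]
  simp only [← Complex.mul_conj]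
  rw [cz]
  simp only [map_mul, map_pow, Complex.conj_conj]
  generalize conj z = w
  generalize conj u = v at hu
  -- With `w`, `v` standing for the conjugates, this is a polynomial identity modulo `u * v = 1`.
  linear_combination (0.675 ^ 2 * z ^ 2 * w ^ 2 * (u * v + 1) + 0.291 ^ 2 * z ^ 3 * w ^ 3
    - 0.675 * 0.291 * z * w * (z ^ 3 * v + w ^ 3 * u) - 2 * 0.675 * 0.033 * z ^ 3 * w ^ 3) * hu

theorem norm_le_one_on_closedBall_of_sphere {f : ℂ → ℂ} (hf : Differentiable ℂ f)
    (h : ∀ z, ‖z‖ = 1 → ‖f z‖ ≤ 1) {z : ℂ} (hz : ‖z‖ ≤ 1) : ‖f z‖ ≤ 1 := by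
  refine Complex.norm_le_of_forall_mem_frontier_norm_le (U := Metric.ball 0 1)
    Metric.isBounded_ball hf.diffContOnCl (fun w hw => h w ?_) ?_
  · rw [frontier_ball _ one_ne_zero] at hw; simpa using hw
  · rw [closure_ball _ one_ne_zero]; simpa using hz

theorem norm_quartic_le_one {p q r : ℂ} (hp : ‖p‖ ≤ 1) (hq : ‖q‖ ≤ 1) (hr : ‖r‖ ≤ 1) :
    ‖0.675 * (p * q + p * r + q * r) ^ 2 - 0.291 * (p + q + r) ^ 2 * (p * q + p * r + q * r) +
      0.033 * (p + q + r) ^ 4‖ ≤ 1 := by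
  refine norm_le_one_on_closedBall_of_sphere (f := fun p => 0.675 * (p * q + p * r + q * r) ^ 2 -
    0.291 * (p + q + r) ^ 2 * (p * q + p * r + q * r) + 0.033 * (p + q + r) ^ 4)
    (by fun_prop) (fun p hp => ?_) hp
  refine norm_le_one_on_closedBall_of_sphere (f := fun q => 0.675 * (p * q + p * r + q * r) ^ 2 -
    0.291 * (p + q + r) ^ 2 * (p * q + p * r + q * r) + 0.033 * (p + q + r) ^ 4)
    (by fun_prop) (fun q hq => ?_) hq
  refine norm_le_one_on_closedBall_of_sphere (f := fun r => 0.675 * (p * q + p * r + q * r) ^ 2 -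
    0.291 * (p + q + r) ^ 2 * (p * q + p * r + q * r) + 0.033 * (p + q + r) ^ 4)
    (by fun_prop) (fun r hr => ?_) hr
  exact norm_quartic_le_one_of_norm_eq_one hp hq hr

/-- Homogeneity of degree 4 gains a factor `ρ ^ 4 < 1`, which makes the closed bound strict. -/
theorem norm_quartic_lt_one {p q r : ℂ} (hp : ‖p‖ < 1) (hq : ‖q‖ < 1) (hr : ‖r‖ < 1) :
    ‖0.675 * (p * q + p * r + q * r) ^ 2 - 0.291 * (p + q + r) ^ 2 * (p * q + p * r + q * r) +
      0.033 * (p + q + r) ^ 4‖ < 1 := by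
  obtain ⟨ρ, hρ, hρ1⟩ := exists_between (max_lt (max_lt hp hq) (max_lt hr zero_lt_one))
  simp only [max_lt_iff] at hρ
  obtain ⟨⟨h1, h2⟩, h3, h0⟩ := hρ
  have hc : (ρ : ℂ) ≠ 0 := by exact_mod_cast h0.ne'
  have hn : ∀ t : ℂ, ‖t‖ < ρ → ‖t / ρ‖ ≤ 1 := fun t ht => by
    rw [norm_div, Complex.norm_real, Real.norm_of_nonneg h0.le]
    exact (div_le_one h0).2 ht.le
  have := norm_quartic_le_one (hn p h1) (hn q h2) (hn r h3)
  calc _ = ‖(ρ : ℂ) ^ 4 * (0.675 * (p / ρ * (q / ρ) + p / ρ * (r / ρ) + q / ρ * (r / ρ)) ^ 2 -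
        0.291 * (p / ρ + q / ρ + r / ρ) ^ 2 * (p / ρ * (q / ρ) + p / ρ * (r / ρ) + q / ρ * (r / ρ)) +
        0.033 * (p / ρ + q / ρ + r / ρ) ^ 4)‖ := by congr 1; field_simp
    _ ≤ ρ ^ 4 * 1 := by
      rw [norm_mul, norm_pow, Complex.norm_real, Real.norm_of_nonneg h0.le]
      gcongr
    _ < 1 := by rw [mul_one]; exact pow_lt_one₀ h0.le hρ1 (by norm_num)

/-! ### `𝔾₃` is a neighbourhood of the origin. -/

theorem symmetrization_three (t : Fin 3 → ℂ) :
    symmetrization 3 t 0 = t 0 + t 1 + t 2 ∧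
    symmetrization 3 t 1 = t 0 * t 1 + t 0 * t 2 + t 1 * t 2 ∧
    symmetrization 3 t 2 = t 0 * t 1 * t 2 := by
  have h1 : Finset.powersetCard 1 (Finset.univ : Finset (Fin 3)) = {{0}, {1}, {2}} := by decide
  have h2 : Finset.powersetCard 2 (Finset.univ : Finset (Fin 3)) = {{0, 1}, {0, 2}, {1, 2}} := by
    decide
  have h3 : Finset.powersetCard 3 (Finset.univ : Finset (Fin 3)) = {{0, 1, 2}} := by decide
  have d1 : ({0} : Finset (Fin 3)) ∉ ({{1}, {2}} : Finset (Finset (Fin 3))) := by decide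
  have d2 : ({1} : Finset (Fin 3)) ∉ ({{2}} : Finset (Finset (Fin 3))) := by decide
  have d3 : ({0, 1} : Finset (Fin 3)) ∉ ({{0, 2}, {1, 2}} : Finset (Finset (Fin 3))) := by decide
  have d4 : ({0, 2} : Finset (Fin 3)) ∉ ({{1, 2}} : Finset (Finset (Fin 3))) := by decide
  refine ⟨?_, ?_, ?_⟩
  · change ∑ s ∈ Finset.powersetCard 1 Finset.univ, ∏ i ∈ s, t i = _
    rw [h1, Finset.sum_insert d1, Finset.sum_insert d2]
    simp [add_assoc]
  · change ∑ s ∈ Finset.powersetCard 2 Finset.univ, ∏ i ∈ s, t i = _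
    rw [h2, Finset.sum_insert d3, Finset.sum_insert d4]
    simp [add_assoc]
  · change ∑ s ∈ Finset.powersetCard 3 Finset.univ, ∏ i ∈ s, t i = _
    rw [h3]
    simp [mul_assoc]

/-- Vieta's formulas for a monic cubic over `ℂ`. -/
theorem exists_vieta_cubic (a b c : ℂ) :
    ∃ p q r : ℂ, p + q + r = a ∧ p * q + p * r + q * r = b ∧ p * q * r = c := by
  obtain ⟨p, hp⟩ : ∃ p : ℂ, p ^ 3 - a * p ^ 2 + b * p - c = 0 := by
    have hdeg : (Cubic.toPoly ⟨1, -a, b, -c⟩ : Polynomial ℂ).degree = 3 :=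
      Cubic.degree_of_a_ne_zero' one_ne_zero
    obtain ⟨p, hp⟩ := IsAlgClosed.exists_root (Cubic.toPoly ⟨1, -a, b, -c⟩ : Polynomial ℂ)
      (by rw [hdeg]; decide)
    refine ⟨p, ?_⟩
    simp [Cubic.toPoly, Polynomial.IsRoot] at hp
    linear_combination hp
  obtain ⟨q, hq⟩ : ∃ q : ℂ, 1 * (q * q) + (-(a - p)) * q + (b - p * (a - p)) = 0 := by
    refine exists_quadratic_eq_zero one_ne_zero ?_
    obtain ⟨s, hs⟩ := IsAlgClosed.exists_pow_nat_eq
      (discrim 1 (-(a - p)) (b - p * (a - p))) (n := 2) (by norm_num)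
    exact ⟨s, by rw [← hs, sq]⟩
  exact ⟨p, q, a - p - q, by ring, by linear_combination -hq,
    by linear_combination hp - p * hq⟩

theorem norm_root_lt_one {a b c t : ℂ} (ha : ‖a‖ < 1 / 4) (hb : ‖b‖ < 1 / 4) (hc : ‖c‖ < 1 / 4)
    (h : t ^ 3 = a * t ^ 2 - b * t + c) : ‖t‖ < 1 := by
  by_contra! ht
  have h1 : ‖t‖ ^ 3 ≤ ‖a‖ * ‖t‖ ^ 2 + ‖b‖ * ‖t‖ + ‖c‖ := by
    rw [← norm_pow, h, ← norm_pow, ← norm_mul, ← norm_mul]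
    exact (norm_add_le _ _).trans (by gcongr; exact norm_sub_le _ _)
  have h2 : ‖a‖ * ‖t‖ ^ 2 ≤ 1 / 4 * ‖t‖ ^ 2 := by gcongr
  have h3 : ‖b‖ * ‖t‖ ≤ 1 / 4 * ‖t‖ := by gcongr
  nlinarith [mul_nonneg (sq_nonneg ‖t‖) (sub_nonneg.2 ht)]

theorem ball_subset_symmetrizedPolydisc_three :
    Metric.ball (0 : Fin 3 → ℂ) (1 / 4) ⊆ symmetrizedPolydisc 3 := by
  intro x hx
  rw [mem_ball_zero_iff, pi_norm_lt_iff (by norm_num)] at hx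
  obtain ⟨p, q, r, h1, h2, h3⟩ := exists_vieta_cubic (x 0) (x 1) (x 2)
  have root : ∀ t : ℂ, (t - p) * (t - q) * (t - r) = 0 → ‖t‖ < 1 := fun t ht =>
    norm_root_lt_one (hx 0) (hx 1) (hx 2) (by rw [← h1, ← h2, ← h3]; linear_combination ht)
  refine ⟨![p, q, r], ?_, ?_⟩
  · intro i
    fin_cases i
    · exact root p (by simp)
    · exact root q (by simp)
    · exact root r (by simp)
  · obtain ⟨e1, e2, e3⟩ := symmetrization_three ![p, q, r]
    funext i
    fin_cases i
    · exact e1.trans h1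
    · exact e2.trans h2
    · exact e3.trans h3

/-! ### Second derivatives through complex lines, and Cauchy estimates. -/

section Slices

variable {E : Type*} [NormedAddCommGroup E] [NormedSpace ℂ E]

theorem hasDerivAt_smul_slice {f : E → ℂ} {X : E} {c : ℂ} (hf : DifferentiableAt ℂ f (c • X)) :
    HasDerivAt (fun c : ℂ => f (c • X)) (fderiv ℂ f (c • X) X) c := by
  have h : HasDerivAt (fun c : ℂ => c • X) X c := by
    simpa using (hasDerivAt_id c).smul_const X
  exact hf.hasFDerivAt.comp_hasDerivAt c h

theorem iteratedFDeriv_two_diag {f : E → ℂ} (X : E) (hf : ∀ᶠ y in nhds (0 : E), DifferentiableAt ℂ f y)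
    (hf' : DifferentiableAt ℂ (fderiv ℂ f) 0) :
    iteratedFDeriv ℂ 2 f 0 (fun _ => X) = iteratedDeriv 2 (fun c : ℂ => f (c • X)) 0 := by
  have hc : Filter.Tendsto (fun c : ℂ => c • X) (nhds 0) (nhds 0) := by
    have : Continuous fun c : ℂ => c • X := by fun_prop
    simpa using this.tendsto 0
  have h1 : deriv (fun c : ℂ => f (c • X)) =ᶠ[nhds 0] fun c => fderiv ℂ f (c • X) X :=
    (hc.eventually hf).mono fun c h => (hasDerivAt_smul_slice h).deriv
  rw [iteratedFDeriv_two_apply, iteratedDeriv_succ, iteratedDeriv_one, h1.deriv_eq]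
  have h : HasDerivAt (fun c : ℂ => c • X) X 0 := by
    simpa using (hasDerivAt_id (0 : ℂ)).smul_const X
  have hf0 : HasFDerivAt (fderiv ℂ f) (fderiv ℂ (fderiv ℂ f) 0) ((0 : ℂ) • X) := by
    rw [zero_smul]; exact hf'.hasFDerivAt
  have h2 : HasDerivAt (fun c : ℂ => fderiv ℂ f (c • X)) (fderiv ℂ (fderiv ℂ f) 0 X) 0 :=
    hf0.comp_hasDerivAt (0 : ℂ) h
  have h3 := ((ContinuousLinearMap.apply ℂ ℂ X).hasFDerivAt).comp_hasDerivAt (0 : ℂ) h2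
  exact h3.deriv.symm

theorem norm_iteratedFDeriv_two_le {f : E → ℂ} {ρ : ℝ} (hρ : 0 < ρ)
    (hd : DifferentiableOn ℂ f (Metric.ball 0 ρ)) (hb : ∀ y ∈ Metric.ball (0 : E) ρ, ‖f y‖ ≤ 1)
    (X : E) :
    ‖iteratedFDeriv ℂ 2 f 0 (fun _ => X)‖ ≤ 2 / (ρ / (2 * (‖X‖ + 1))) ^ 2 := by
  have hX : 0 < ‖X‖ + 1 := by positivity
  -- If this fails, the second derivative is `0` by convention and the bound is trivial.
  by_cases hf' : DifferentiableAt ℂ (fderiv ℂ f) 0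
  · have hat : ∀ y ∈ Metric.ball (0 : E) ρ, DifferentiableAt ℂ f y := fun y hy =>
      hd.differentiableAt (Metric.isOpen_ball.mem_nhds hy)
    rw [iteratedFDeriv_two_diag X (Filter.mem_of_superset (Metric.ball_mem_nhds 0 hρ) hat) hf']
    have hR : 0 < ρ / (2 * (‖X‖ + 1)) := by positivity
    have hmem : ∀ c ∈ Metric.closedBall (0 : ℂ) (ρ / (2 * (‖X‖ + 1))),
        c • X ∈ Metric.ball (0 : E) ρ := by
      intro c hc
      rw [mem_closedBall_zero_iff, le_div_iff₀ (by positivity)] at hc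
      rw [mem_ball_zero_iff, norm_smul]
      nlinarith [norm_nonneg c, mul_nonneg (norm_nonneg c) (norm_nonneg X)]
    have hdiff : DifferentiableOn ℂ (fun c : ℂ => f (c • X))
        (closure (Metric.ball (0 : ℂ) (ρ / (2 * (‖X‖ + 1))))) := by
      rw [closure_ball _ hR.ne']
      intro c hc
      exact (hasDerivAt_smul_slice (hat _ (hmem c hc))).differentiableAt.differentiableWithinAt
    have := Complex.norm_iteratedDeriv_le_of_forall_mem_sphere_norm_le 2 hR hdiff.diffContOnCl
      (C := 1) fun c hc => hb _ (hmem c (Metric.sphere_subset_closedBall hc))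
    simpa using this
  · rw [iteratedFDeriv_two_apply, fderiv_zero_of_not_differentiableAt hf']
    simp only [zero_apply, norm_zero]
    positivity

/-- Needed for `le_csSup`: a real `sSup` bounds its set only if the set is bounded above. -/
theorem bddAbove_reiffen_two {D : Set E} (hD : D ∈ nhds 0) (X : E) :
    BddAbove ((fun f : E → ℂ =>
      ‖iteratedFDeriv ℂ 2 f 0 (fun _ => X) / (Nat.factorial 2 : ℂ)‖ ^ (1 / ((2 : ℕ) : ℝ))) ''
        reiffenCompetitors 2 D 0) := by
  obtain ⟨ρ, hρ, hsub⟩ := Metric.mem_nhds_iff.1 hD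
  refine ⟨(2 / (ρ / (2 * (‖X‖ + 1))) ^ 2) ^ (1 / ((2 : ℕ) : ℝ)), ?_⟩
  rintro _ ⟨f, ⟨hd, hm, -⟩, rfl⟩
  have hb := norm_iteratedFDeriv_two_le hρ (hd.mono hsub)
    (fun y hy => by simpa using (mem_ball_zero_iff.1 (hm (hsub hy))).le) X
  refine Real.rpow_le_rpow (norm_nonneg _) ?_ (by positivity)
  rw [norm_div]
  refine (div_le_self (norm_nonneg _) ?_).trans hb
  simp

end Slices

/-! ### The competitor and the resulting seminorm. -/

/-- The competitor on `𝔾₃` that gives the lower bound. -/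
def quarticCompetitor (x : Fin 3 → ℂ) : ℂ :=
  0.675 * x 1 ^ 2 - 0.291 * x 0 ^ 2 * x 1 + 0.033 * x 0 ^ 4

theorem contDiff_quarticCompetitor : ContDiff ℂ 2 quarticCompetitor := by
  unfold quarticCompetitor; fun_prop

theorem quarticCompetitor_smul (X : Fin 3 → ℂ) (c : ℂ) :
    quarticCompetitor (c • X) = 0.675 * X 1 ^ 2 * c ^ 2 - 0.291 * X 0 ^ 2 * X 1 * c ^ 3 +
      0.033 * X 0 ^ 4 * c ^ 4 := by
  simp only [quarticCompetitor, Pi.smul_apply, smul_eq_mul]; ring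

theorem deriv_quarticCompetitor_smul (X : Fin 3 → ℂ) :
    deriv (fun c : ℂ => quarticCompetitor (c • X)) = fun c => 1.35 * X 1 ^ 2 * c -
      0.873 * X 0 ^ 2 * X 1 * c ^ 2 + 0.132 * X 0 ^ 4 * c ^ 3 := by
  funext c
  simp only [quarticCompetitor_smul]
  have h := (((hasDerivAt_pow 2 c).const_mul (0.675 * X 1 ^ 2)).sub
    ((hasDerivAt_pow 3 c).const_mul (0.291 * X 0 ^ 2 * X 1))).add
    ((hasDerivAt_pow 4 c).const_mul (0.033 * X 0 ^ 4))
  refine h.deriv.trans ?_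
  norm_num
  ring

theorem iteratedFDeriv_two_quarticCompetitor (X : Fin 3 → ℂ) :
    iteratedFDeriv ℂ 2 quarticCompetitor 0 (fun _ => X) = 1.35 * X 1 ^ 2 := by
  have hd : Differentiable ℂ quarticCompetitor := contDiff_quarticCompetitor.differentiable (by norm_num)
  have hd' : Differentiable ℂ (fderiv ℂ quarticCompetitor) :=
    (contDiff_quarticCompetitor.fderiv_right (m := 1) (by norm_num)).differentiable (by norm_num)
  rw [iteratedFDeriv_two_diag X (Filter.Eventually.of_forall hd) (hd' 0), iteratedDeriv_succ,
    iteratedDeriv_one, deriv_quarticCompetitor_smul]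
  have h := (((hasDerivAt_id (0 : ℂ)).const_mul (1.35 * X 1 ^ 2)).sub
    ((hasDerivAt_pow 2 (0 : ℂ)).const_mul (0.873 * X 0 ^ 2 * X 1))).add
    ((hasDerivAt_pow 3 (0 : ℂ)).const_mul (0.132 * X 0 ^ 4))
  refine h.deriv.trans ?_
  simp

theorem quarticCompetitor_mem :
    quarticCompetitor ∈ reiffenCompetitors 2 (symmetrizedPolydisc 3) 0 := by
  have hd : Differentiable ℂ quarticCompetitor := contDiff_quarticCompetitor.differentiable (by norm_num)
  refine ⟨hd.differentiableOn, ?_, ?_⟩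
  · rintro _ ⟨t, ht, rfl⟩
    obtain ⟨e1, e2, -⟩ := symmetrization_three t
    rw [mem_ball_zero_iff, quarticCompetitor, e1, e2]
    exact norm_quartic_lt_one (ht 0) (ht 1) (ht 2)
  · intro j hj
    interval_cases j
    · ext m; simp [quarticCompetitor]
    · ext m
      rw [iteratedFDeriv_one_apply]
      have h := (hasDerivAt_smul_slice (X := m 0) (c := 0) (hd _)).deriv
      rw [deriv_quarticCompetitor_smul, zero_smul] at h
      rw [← h]; simp

/-- The pseudonorm `X ↦ √0.675 |X₂|`. -/
noncomputable def scaledCoordSeminorm : Seminorm ℂ (Fin 3 → ℂ) :=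
  (NNReal.sqrt 0.675) • (normSeminorm ℂ ℂ).comp (LinearMap.proj 1)

theorem scaledCoordSeminorm_apply (X : Fin 3 → ℂ) :
    scaledCoordSeminorm X = Real.sqrt 0.675 * ‖X 1‖ := by
  simp [scaledCoordSeminorm, NNReal.smul_def]

theorem scaledCoordSeminorm_le_reiffen (X : Fin 3 → ℂ) :
    scaledCoordSeminorm X ≤ reiffen 2 (symmetrizedPolydisc 3) 0 X := by
  have hD : symmetrizedPolydisc 3 ∈ nhds 0 :=
    Filter.mem_of_superset (Metric.ball_mem_nhds 0 (by norm_num))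
      ball_subset_symmetrizedPolydisc_three
  refine le_trans (le_of_eq ?_)
    (le_csSup (bddAbove_reiffen_two hD X) ⟨quarticCompetitor, quarticCompetitor_mem, rfl⟩)
  simp only [iteratedFDeriv_two_quarticCompetitor]
  rw [scaledCoordSeminorm_apply, Nat.cast_ofNat, ← Real.sqrt_eq_rpow,
    show (1.35 * X 1 ^ 2 / (Nat.factorial 2 : ℂ)) = ((0.675 : ℝ) : ℂ) * X 1 ^ 2 by
      push_cast [Nat.factorial]; ring,
    norm_mul, norm_pow, Complex.norm_real, Real.norm_of_nonneg (by norm_num),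
    Real.sqrt_mul (by norm_num), Real.sqrt_sq (norm_nonneg _)]

theorem lemma7 :
    Real.sqrt 0.675 ≤ reiffenHat 2 (symmetrizedPolydisc 3) 0 (Pi.single 1 1) ∧
      0.8215 < Real.sqrt 0.675 ∧ Real.sqrt 0.675 < 0.8216 := by
  refine ⟨?_, Real.lt_sqrt_of_sq_lt (by norm_num), (Real.sqrt_lt' (by norm_num)).2 (by norm_num)⟩
  have h : scaledCoordSeminorm (Pi.single 1 1) ≤
      reiffenHat 2 (symmetrizedPolydisc 3) 0 (Pi.single 1 1) := (largestPseudonormBelow_isGreatest (reiffen 2 (symmetrizedPolydisc 3) 0)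
    (reiffen_nonneg 2 (symmetrizedPolydisc 3) 0)).2 scaledCoordSeminorm_le_reiffen
    (Pi.single 1 1)
  simpa [scaledCoordSeminorm_apply] using h
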